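/- Let $(Y_i)_{i\ge 1}$ and $(Z_i)_{i\ge 1}$ be real-valued stochastic processes on a common probability space, let $\lambda\in[0,1]$, and for $n\in\mathbb N$ put $\ell=\lfloor\lambda n\rfloor$ and $\mathbf x^{(n)}=[X_1\,\dots\,X_n]^{\mathsf T}=[Y_1\,\dots\,Y_{n-\ell}\;Z_1\,\dots\,Z_\ell]^{\mathsf T}$. Suppose that for each $n$ the entries $X_1,\dots,X_n$ of $\mathbf x^{(n)}$ are independent, that $X_i$ has the distribution $(1-\rho_1)\mu_{\mathrm d_1}+\rho_1\mu_{\mathrm c_1}$ for $1\le i\le n-\ell$ and the distribution $(1-\rho_2)\mu_{\mathrm d_2}+\rho_2\mu_{\mathrm c_2}$ for $n-\ell<i\le n$, where $\rho_1,\rho_2\in[0,1]$, the $\mu_{\mathrm d_j}$ are discrete probability distributions on $\mathbb R$, and the $\mu_{\mathrm c_j}$ are probability distributions on $\mathbb R$ that are absolutely continuous with respect to Lebesgue measure (none of which depends on $n$). For a nonempty bounded set $S\subseteq\mathbb R^n$ let $N_S(\delta)$ be the least number of open Euclidean balls of radius $\delta$ needed to cover $S$, and let $$\underline{\dim}_{\mathrm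 B}(S)=\liminf_{\delta\to0}\frac{\log N_S(\delta)}{\log(1/\delta)},\qquad \overline{\dim}_{\mathrm B}(S)=\limsup_{\delta\to0}\frac{\log N_S(\delta)}{\log(1/\delta)}$$ be its lower and upper Minkowski dimension. For $\varepsilon>0$ define the lower and upper Minkowski dimension compression rates by $$\underline R_{\mathrm B}(\varepsilon)=\limsup_{n\to\infty}\ \inf_{S}\frac{\underline{\dim}_{\mathrm B}(S)}{n},\qquad \overline R_{\mathrm B}(\varepsilon)=\limsup_{n\to\infty}\ \inf_{S}\frac{\overline{\dim}_{\mathrm B}(S)}{n},$$ where both infima are over all nonempty bounded Borel sets $S\subseteq\mathbb R^n$ with $\mathbb P[\mathbf x^{(n)}\in S]\ge 1-\varepsilon$. When the two rates coincide, their common value is the Minkowski dimension compression rate $R_{\mathrm B}(\varepsilon)$. Then for every $\varepsilon\in(0,1)$ the two rates coincide, and $$R_{\mathrm B}(\varepsilon)=(1-\lambda)\rho_1+\lambda\rho_2 .$$ -/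

import Mathlib

open Filter Topology MeasureTheory ProbabilityTheory

namespace SignalSeparation

/-- Covering number `N_S(δ)`: the least number of open Euclidean balls of radius `δ`,
with arbitrary centers in `ℝⁿ`, whose union contains `S`. (For bounded `S` and `δ > 0` the set of
admissible `m` is nonempty.) -/
noncomputable def coveringNumber {n : ℕ} (S : Set (EuclideanSpace ℝ (Fin n))) (δ : ℝ) : ℕ :=
  sInf {m : ℕ | ∃ x : Fin m → EuclideanSpace ℝ (Fin n), S ⊆ ⋃ i, Metric.ball (x i) δ}

/-- The quotient `log N_S(δ) / log (1/δ)`, as an extended real number. -/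
noncomputable def coveringExponent {n : ℕ} (S : Set (EuclideanSpace ℝ (Fin n))) (δ : ℝ) : EReal :=
  ((Real.log (coveringNumber S δ) / Real.log (1 / δ) : ℝ) : EReal)

/-- Lower Minkowski (box-counting) dimension of a nonempty bounded set `S ⊆ ℝⁿ`. -/
noncomputable def lowerMinkowskiDim {n : ℕ} (S : Set (EuclideanSpace ℝ (Fin n))) : EReal :=
  liminf (fun δ : ℝ => coveringExponent S δ) (𝓝[>] 0)

/-- Upper Minkowski (box-counting) dimension of a nonempty bounded set `S ⊆ ℝⁿ`. -/
noncomputable def upperMinkowskiDim {n : ℕ} (S : Set (EuclideanSpace ℝ (Fin n))) : EReal :=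
  limsup (fun δ : ℝ => coveringExponent S δ) (𝓝[>] 0)

variable {Ω : Type*} [MeasurableSpace Ω]

/-- The number `ℓ = ⌊lam * n⌋` of components taken from the second process. -/
noncomputable def numZ (lam : ℝ) (n : ℕ) : ℕ := ⌊lam * n⌋₊

/-- The concatenated source vector of dimension `n`: its first `n - ℓ` entries are the first
`n - ℓ` members of the process `Y`, its last `ℓ` entries are the first `ℓ` members of `Z`
(all indices start at `0`). -/
noncomputable def concatSource (lam : ℝ) (Y Z : ℕ → Ω → ℝ) (n : ℕ) (ω : Ω) :
    EuclideanSpace ℝ (Fin n) :=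
  WithLp.toLp 2 fun i : Fin n =>
    if (i : ℕ) < n - numZ lam n then Y i ω else Z (i - (n - numZ lam n)) ω

/-- The approximate support sets over which the compression rates are optimized: the nonempty
bounded (measurable) sets `S ⊆ ℝⁿ` with `ℙ[x ∈ S] ≥ 1 - ε`. -/
def approxSupports {n : ℕ} (P : Measure Ω) (x : Ω → EuclideanSpace ℝ (Fin n)) (ε : ℝ) :
    Set (Set (EuclideanSpace ℝ (Fin n))) :=
  {S | S.Nonempty ∧ Bornology.IsBounded S ∧ MeasurableSet S ∧
    ENNReal.ofReal (1 - ε) ≤ P {ω | x ω ∈ S}}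

/-- Lower Minkowski dimension compression rate of a sequence of random vectors `x n` in `ℝⁿ`:
the limit superior of the infima of the normalized lower dimensions. -/
noncomputable def lowerMinkowskiRate (P : Measure Ω)
    (x : (n : ℕ) → Ω → EuclideanSpace ℝ (Fin n)) (ε : ℝ) : EReal :=
  limsup (fun n : ℕ => ⨅ S ∈ approxSupports P (x n) ε, lowerMinkowskiDim S / (n : EReal)) atTop

/-- Upper Minkowski dimension compression rate of a sequence of random vectors `x n` in `ℝⁿ`:
the limit superior of the infima of the normalized upper dimensions. -/
noncomputable def upperMinkowskiRate (P : Measure Ω)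
    (x : (n : ℕ) → Ω → EuclideanSpace ℝ (Fin n)) (ε : ℝ) : EReal :=
  limsup (fun n : ℕ => ⨅ S ∈ approxSupports P (x n) ε, upperMinkowskiDim S / (n : EReal)) atTop

/-- `r` is the Minkowski dimension compression rate `R_B(ε)`: the lower and the upper rate coincide
and their common value is `r`. -/
def IsMinkowskiRate (P : Measure Ω) (x : (n : ℕ) → Ω → EuclideanSpace ℝ (Fin n)) (ε r : ℝ) : Prop :=
  lowerMinkowskiRate P x ε = (r : EReal) ∧ upperMinkowskiRate P x ε = (r : EReal)

/-- A discrete distribution on `ℝ`: a probability measure carried by a countable set. -/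
def IsDiscreteDistribution (μ : Measure ℝ) : Prop :=
  IsProbabilityMeasure μ ∧ ∃ C : Set ℝ, C.Countable ∧ μ Cᶜ = 0

/-- An absolutely continuous distribution on `ℝ`. -/
def IsContinuousDistribution (μ : Measure ℝ) : Prop :=
  IsProbabilityMeasure μ ∧ μ ≪ volume

/-- The measure `μ` is a mixture `(1 - ρ) μd + ρ μc` of a discrete and an absolutely continuous
distribution, with mixture parameter `ρ ∈ [0, 1]`. -/
def IsMixedDistribution (ρ : ℝ) (μ : Measure ℝ) : Prop :=
  0 ≤ ρ ∧ ρ ≤ 1 ∧ ∃ μd μc : Measure ℝ, IsDiscreteDistribution μd ∧ IsContinuousDistribution μc ∧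
    μ = ENNReal.ofReal (1 - ρ) • μd + ENNReal.ofReal ρ • μc

/-- The concatenated source has a mixed discrete-continuous distribution with mixture parameters
`ρ₁` and `ρ₂`: for each `n` the entries of the source vector are independent, its first `n - ℓ`
entries have a common mixed law `μ₁` with parameter `ρ₁`, and its last `ℓ` entries have a common
mixed law `μ₂` with parameter `ρ₂`. -/
def IsMixedSource (P : Measure Ω) (lam ρ₁ ρ₂ : ℝ) (Y Z : ℕ → Ω → ℝ) : Prop :=
  ∃ μ₁ μ₂ : Measure ℝ, IsMixedDistribution ρ₁ μ₁ ∧ IsMixedDistribution ρ₂ μ₂ ∧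
    ∀ n : ℕ, iIndepFun (fun (i : Fin n) (ω : Ω) => concatSource lam Y Z n ω i) P ∧
      ∀ i : Fin n, P.map (fun ω => concatSource lam Y Z n ω i) =
        if (i : ℕ) < n - numZ lam n then μ₁ else μ₂

end SignalSeparation

/-!
Call a coordinate *regular* if it falls in a region where its law has a bounded density. The
absolutely continuous part of a mixed law provides such a region of mass almost `ρ i`, and the
complement of a suitable finite set of atoms has mass at most slightly more than `ρ i`. By
independence and Chebyshev's inequality, with high probability about `∑ i, ρ i` of the coordinates
are regular, and all but about `∑ i, ρ i` of them are atoms of this finite set.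

Lower bound: on the event that at least `k` coordinates are regular, a ball of radius `δ` has
probability `O(δ ^ k)`, so by the mass distribution principle every bounded set that meets this
event with positive probability has lower Minkowski dimension at least `k`.

Upper bound: the bounded vectors with at most `k` coordinates outside a finite set lie in a finite
union of `k`-dimensional boxes, which has upper Minkowski dimension at most `k`.

Chebyshev's error is `o(n)`, hence invisible after dividing by `n`.
-/

namespace SignalSeparation

section HitCount

open scoped Classical in
/-- The number of coordinates `i` for which `x i` lies in the prescribed set `B i`. It counts the
coordinates of a source vector that fall in the region of bounded density, or outside the atoms. -/
noncomputable def hitCount {ι : Type*} [Fintype ι] {α : ι → Type*} (B : ∀ i, Set (α i))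
    (x : ∀ i, α i) : ℕ :=
  Finset.card {i | x i ∈ B i}

variable {ι : Type*} [Fintype ι] {α : ι → Type*} {B : ∀ i, Set (α i)}

theorem cast_hitCount (B : ∀ i, Set (α i)) (x : ∀ i, α i) :
    (hitCount B x : ℝ) = ∑ i, (B i).indicator 1 (x i) := by
  classical simp [hitCount, Set.indicator_apply]

theorem le_hitCount_iff {k : ℕ} {x : ∀ i, α i} :
    k ≤ hitCount B x ↔ ∃ T ∈ Finset.univ.powersetCard k, ∀ i ∈ T, x i ∈ B i := by
  simp only [hitCount, Finset.le_card_iff_exists_subset_card, Finset.mem_powersetCard_univ,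
    Finset.subset_iff, Finset.mem_filter_univ, and_comm]

variable [∀ i, MeasurableSpace (α i)]

theorem measurable_hitCount (hB : ∀ i, MeasurableSet (B i)) : Measurable (hitCount B) := by
  classical
  have hsum : hitCount B = fun x => ∑ i, if x i ∈ B i then 1 else 0 :=
    funext fun _ => Finset.card_filter _ _
  rw [hsum]
  exact Finset.measurable_sum _ fun i _ =>
    Measurable.ite (measurable_pi_apply i (hB i)) measurable_const measurable_const

variable {Ω : Type*} [MeasurableSpace Ω] {P : Measure Ω}
  {X : ∀ i, Ω → α i}

theorem measureReal_le_abs_hitCount_sub_le [IsProbabilityMeasure P] (hind : iIndepFun X P)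
    (hX : ∀ i, AEMeasurable (X i) P) (hB : ∀ i, MeasurableSet (B i)) {t : ℝ} (ht : 0 < t) :
    P.real {ω | t ≤ |hitCount B (X · ω) - ∑ i, (P.map (X i)).real (B i)|} ≤
      Fintype.card ι / (4 * t ^ 2) := by
  let I (i : ι) : α i → ℝ := (B i).indicator 1
  have hI i : Measurable (I i) := measurable_one.indicator (hB i)
  have hIX i : AEMeasurable (I i ∘ X i) P := (hI i).comp_aemeasurable (hX i)
  have hI01 i ω : (I i ∘ X i) ω ∈ Set.Icc (0 : ℝ) 1 :=
    ⟨Set.indicator_nonneg (fun _ _ => zero_le_one) _,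
      Set.indicator_le_self' (fun _ _ => zero_le_one) _⟩
  have hL2 i : MemLp (I i ∘ X i) 2 P :=
    memLp_of_bounded (ae_of_all _ (hI01 i)) (hIX i).aestronglyMeasurable 2
  have hcount ω : (∑ i, I i ∘ X i) ω = hitCount B (X · ω) := by
    simp only [cast_hitCount, Finset.sum_apply, Function.comp_apply, I]
  have hmean : P[∑ i, I i ∘ X i] = ∑ i, (P.map (X i)).real (B i) := by
    simp only [Finset.sum_apply]
    rw [integral_finsetSum _ fun i _ => (hL2 i).integrable one_le_two]
    refine Finset.sum_congr rfl fun i _ => ?_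
    rw [← integral_indicator_one (hB i)]
    exact (integral_map (hX i) (hI i).aestronglyMeasurable).symm
  have hvar : Var[∑ i, I i ∘ X i; P] ≤ Fintype.card ι / 4 := by
    have hindI : iIndepFun (fun i => I i ∘ X i) P := hind.comp I hI
    calc Var[∑ i, I i ∘ X i; P] = ∑ i, Var[I i ∘ X i; P] :=
          IndepFun.variance_sum (fun i _ => hL2 i) fun i _ j _ hij => hindI.indepFun hij
      _ ≤ ∑ _i : ι, ((1 - 0) / 2 : ℝ) ^ 2 :=
          Finset.sum_le_sum fun i _ => variance_le_sq_of_bounded (ae_of_all _ (hI01 i)) (hIX i)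
      _ = Fintype.card ι / 4 := by
          rw [Finset.sum_const, Finset.card_univ, nsmul_eq_mul]
          ring
  have hcheb := meas_ge_le_variance_div_sq (memLp_finsetSum' Finset.univ fun i _ => hL2 i) ht
  rw [hmean] at hcheb
  simp only [hcount] at hcheb
  calc P.real {ω | t ≤ |hitCount B (X · ω) - ∑ i, (P.map (X i)).real (B i)|}
      ≤ Var[∑ i, I i ∘ X i; P] / t ^ 2 :=
        ENNReal.toReal_le_of_le_ofReal (div_nonneg (variance_nonneg _ _) (sq_nonneg t)) hcheb
    _ ≤ Fintype.card ι / 4 / t ^ 2 := by gcongr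
    _ = Fintype.card ι / (4 * t ^ 2) := div_div _ _ _

theorem measureReal_hitCount_lt_le [IsProbabilityMeasure P] (hind : iIndepFun X P)
    (hX : ∀ i, AEMeasurable (X i) P) (hB : ∀ i, MeasurableSet (B i)) {a t : ℝ} (ht : 0 < t)
    (hat : a + t ≤ ∑ i, (P.map (X i)).real (B i)) :
    P.real {ω | hitCount B (X · ω) < a} ≤ Fintype.card ι / (4 * t ^ 2) := by
  refine (measureReal_mono fun ω (hω : _ < a) => ?_).trans
    (measureReal_le_abs_hitCount_sub_le hind hX hB ht)
  exact (by linarith : t ≤ _).trans (neg_le_abs _)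

theorem measureReal_lt_hitCount_le [IsProbabilityMeasure P] (hind : iIndepFun X P)
    (hX : ∀ i, AEMeasurable (X i) P) (hB : ∀ i, MeasurableSet (B i)) {a t : ℝ} (ht : 0 < t)
    (hat : ∑ i, (P.map (X i)).real (B i) + t ≤ a) :
    P.real {ω | a < hitCount B (X · ω)} ≤ Fintype.card ι / (4 * t ^ 2) := by
  refine (measureReal_mono fun ω (hω : a < _) => ?_).trans
    (measureReal_le_abs_hitCount_sub_le hind hX hB ht)
  exact (by linarith : t ≤ _).trans (le_abs_self _)

theorem measureReal_le_hitCount_le (hind : iIndepFun X P) (hX : ∀ i, AEMeasurable (X i) P)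
    (hB : ∀ i, MeasurableSet (B i)) {p : ℝ} (hp : ∀ i, (P.map (X i)).real (B i) ≤ p) (k : ℕ) :
    P.real {ω | k ≤ hitCount B (X · ω)} ≤ (Fintype.card ι).choose k * p ^ k := by
  have hsub : {ω | k ≤ hitCount B (X · ω)} =
      ⋃ T ∈ Finset.univ.powersetCard k, ⋂ i ∈ T, X i ⁻¹' B i := by
    ext ω
    simp only [Set.mem_ofPred_eq, le_hitCount_iff, Set.mem_iUnion, Set.mem_iInter, Set.mem_preimage,
      exists_prop]
  have hprod (T : Finset ι) :
      P.real (⋂ i ∈ T, X i ⁻¹' B i) = ∏ i ∈ T, (P.map (X i)).real (B i) := by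
    simp only [measureReal_def, hind.measure_inter_preimage_eq_mul T fun i _ => hB i,
      ENNReal.toReal_prod, Measure.map_apply_of_aemeasurable (hX _) (hB _)]
  calc P.real {ω | k ≤ hitCount B (X · ω)}
      ≤ ∑ T ∈ Finset.univ.powersetCard k, P.real (⋂ i ∈ T, X i ⁻¹' B i) :=
        hsub ▸ measureReal_biUnion_finset_le _ _
    _ ≤ ∑ _T ∈ (Finset.univ : Finset ι).powersetCard k, p ^ k := by
        refine Finset.sum_le_sum fun T hT => ?_
        rw [hprod, ← (Finset.mem_powersetCard_univ.1 hT), ← Finset.prod_const]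
        exact Finset.prod_le_prod (fun _ _ => measureReal_nonneg) fun i _ => hp i
    _ = (Fintype.card ι).choose k * p ^ k := by
        rw [Finset.sum_const, Finset.card_powersetCard, Finset.card_univ, nsmul_eq_mul]

end HitCount

section Approximation

variable {α : Type*} [MeasurableSpace α] {μ ν : Measure α} [IsFiniteMeasure μ] {η : ℝ}

theorem exists_measureReal_compl_lt_of_monotone {A : ℕ → Set α} (hA : ∀ m, MeasurableSet (A m))
    (hmono : Monotone A) (hcover : ∀ᵐ x ∂μ, x ∈ ⋃ m, A m) (hη : 0 < η) :
    ∃ m, μ.real (A m)ᶜ < η := by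
  have hlim : Tendsto (fun m => μ (A m)ᶜ) atTop (𝓝 0) := by
    have hnull : μ (⋂ m, (A m)ᶜ) = 0 := by rwa [← Set.compl_iUnion, ← mem_ae_iff]
    rw [← hnull]
    exact tendsto_measure_iInter_atTop (fun m => (hA m).compl.nullMeasurableSet)
      (fun _ _ h => Set.compl_subset_compl.2 (hmono h)) ⟨0, measure_ne_top _ _⟩
  have hlim' : Tendsto (fun m => μ.real (A m)ᶜ) atTop (𝓝 0) :=
    (ENNReal.tendsto_toReal ENNReal.zero_ne_top).comp hlim
  exact (hlim'.eventually_lt_const hη).exists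

theorem exists_finset_measureReal_compl_lt [MeasurableSingletonClass α] {C : Set α}
    (hC : C.Countable) (hCμ : μ Cᶜ = 0) (hη : 0 < η) : ∃ F : Finset α, μ.real (F : Set α)ᶜ < η := by
  obtain ⟨m, hm⟩ := exists_measureReal_compl_lt_of_monotone (μ := μ)
    (fun m => (hC.finiteExhaustion.finite m).measurableSet)
    (fun _ _ => hC.finiteExhaustion.mono)
    (by rwa [hC.finiteExhaustion.iUnion_eq]) hη
  refine ⟨(hC.finiteExhaustion.finite m).toFinset, ?_⟩
  rwa [Set.Finite.coe_toFinset]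

theorem exists_measure_inter_le_mul_of_absolutelyContinuous [SigmaFinite ν] (hμν : μ ≪ ν)
    (hη : 0 < η) :
    ∃ G, MeasurableSet G ∧ μ.real Gᶜ < η ∧ ∃ m : ℕ, ∀ B, μ (G ∩ B) ≤ m * ν B := by
  let f := μ.rnDeriv ν
  have hf : Measurable f := Measure.measurable_rnDeriv μ ν
  have hA (m : ℕ) : MeasurableSet {x | f x ≤ m} := hf measurableSet_Iic
  have hmono : Monotone fun m : ℕ => {x | f x ≤ m} := fun _ _ h x (hx : f x ≤ _) =>
    hx.trans (Nat.cast_le.2 h)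
  have hcover : ∀ᵐ x ∂μ, x ∈ ⋃ m : ℕ, {x | f x ≤ m} := by
    filter_upwards [hμν.ae_le (Measure.rnDeriv_lt_top μ ν)] with x hx
    obtain ⟨m, hm⟩ := ENNReal.exists_nat_gt hx.ne
    exact Set.mem_iUnion.2 ⟨m, hm.le⟩
  obtain ⟨m, hm⟩ := exists_measureReal_compl_lt_of_monotone hA hmono hcover hη
  refine ⟨{x | f x ≤ m}, hA m, hm, m, fun B => ?_⟩
  calc μ ({x | f x ≤ m} ∩ B) = ∫⁻ x in {x | f x ≤ m} ∩ B, f x ∂ν := by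
        rw [← withDensity_apply', Measure.withDensity_rnDeriv_eq μ ν hμν]
    _ ≤ ∫⁻ _x in {x | f x ≤ m} ∩ B, m ∂ν := setLIntegral_mono measurable_const fun x hx => hx.1
    _ = m * ν ({x | f x ≤ m} ∩ B) := setLIntegral_const _ _
    _ ≤ m * ν B := by gcongr; exact Set.inter_subset_right

end Approximation

section MixedDistribution

variable {ρ η : ℝ} {μ : Measure ℝ}

theorem IsMixedDistribution.exists_measureReal_eq (h : IsMixedDistribution ρ μ) :
    ∃ μd μc : Measure ℝ, IsDiscreteDistribution μd ∧ IsContinuousDistribution μc ∧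
      ∀ s, μ.real s = (1 - ρ) * μd.real s + ρ * μc.real s := by
  obtain ⟨h0, h1, μd, μc, hd, hc, rfl⟩ := h
  have := hd.1
  have := hc.1
  refine ⟨μd, μc, hd, hc, fun s => ?_⟩
  simp [measureReal_def, ENNReal.toReal_add, ENNReal.mul_ne_top, h0, h1]

theorem IsMixedDistribution.isProbabilityMeasure (h : IsMixedDistribution ρ μ) :
    IsProbabilityMeasure μ := by
  obtain ⟨h0, h1, μd, μc, ⟨_, -⟩, ⟨_, -⟩, rfl⟩ := h
  refine ⟨?_⟩
  simp [← ENNReal.ofReal_add (sub_nonneg.2 h1) h0]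

theorem IsMixedDistribution.aemeasurable {Ω : Type*} [MeasurableSpace Ω] {P : Measure Ω}
    {X : Ω → ℝ} (h : IsMixedDistribution ρ (P.map X)) : AEMeasurable X P :=
  have := h.isProbabilityMeasure
  aemeasurable_of_map_neZero inferInstance

theorem IsMixedDistribution.exists_bounded_density (h : IsMixedDistribution ρ μ) (hη : 0 < η) :
    ∃ G, MeasurableSet G ∧ ρ - η ≤ μ.real G ∧
      ∃ M : ℝ, ∀ a δ, 0 < δ → μ.real (G ∩ Metric.ball a δ) ≤ M * δ := by
  have hρ0 := h.1
  have hρ1 := h.2.1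
  obtain ⟨μd, μc, ⟨_, C, hC, hCd⟩, ⟨_, hac⟩, hμ⟩ := h.exists_measureReal_eq
  obtain ⟨G, hG, hGη, m, hGm⟩ := exists_measure_inter_le_mul_of_absolutelyContinuous hac hη
  have hCc : μc C = 0 := hac (hC.measure_zero volume)
  refine ⟨G \ C, hG.diff hC.measurableSet, ?_, 2 * m, fun a δ hδ => ?_⟩
  · have hGC : μc.real (G \ C) = 1 - μc.real Gᶜ := by
      rw [measureReal_def, measure_sdiff_null hCc, ← measureReal_def,
        probReal_compl_eq_one_sub hG, sub_sub_cancel]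
    rw [hμ, hGC]
    nlinarith [measureReal_nonneg (μ := μd) (s := G \ C), measureReal_nonneg (μ := μc) (s := Gᶜ)]
  · have hd : μd.real ((G \ C) ∩ Metric.ball a δ) = 0 := by
      rw [measureReal_def, measure_mono_null (fun x hx => hx.1.2) hCd, ENNReal.toReal_zero]
    have hc : μc.real ((G \ C) ∩ Metric.ball a δ) ≤ m * (2 * δ) :=
      calc μc.real ((G \ C) ∩ Metric.ball a δ)
          ≤ μc.real (G ∩ Metric.ball a δ) :=
            measureReal_mono (Set.inter_subset_inter_left _ Set.sdiff_subset)
        _ ≤ (m * volume (Metric.ball a δ)).toReal :=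
            ENNReal.toReal_mono (by finiteness) (hGm _)
        _ = m * (2 * δ) := by simp [Real.volume_ball, hδ.le]
    rw [hμ, hd]
    nlinarith [measureReal_nonneg (μ := μc) (s := (G \ C) ∩ Metric.ball a δ)]

theorem IsMixedDistribution.exists_finset_measureReal_compl_le (h : IsMixedDistribution ρ μ)
    (hη : 0 < η) : ∃ F : Finset ℝ, μ.real (F : Set ℝ)ᶜ ≤ ρ + η := by
  have hρ0 := h.1
  obtain ⟨μd, μc, ⟨_, C, hC, hCd⟩, ⟨_, -⟩, hμ⟩ := h.exists_measureReal_eq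
  obtain ⟨F, hF⟩ := exists_finset_measureReal_compl_lt hC hCd hη
  refine ⟨F, ?_⟩
  rw [hμ]
  nlinarith [measureReal_nonneg (μ := μd) (s := (F : Set ℝ)ᶜ),
    measureReal_le_one (μ := μc) (s := (F : Set ℝ)ᶜ)]

theorem exists_finset_forall_measureReal_compl_le {ι : Type*} [Finite ι] {μ : ι → Measure ℝ}
    {ρ : ι → ℝ} (hmixed : ∀ i, IsMixedDistribution (ρ i) (μ i)) (hη : 0 < η) :
    ∃ F : Finset ℝ, ∀ i, (μ i).real (F : Set ℝ)ᶜ ≤ ρ i + η := by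
  have := Fintype.ofFinite ι
  choose F hF using fun i => (hmixed i).exists_finset_measureReal_compl_le hη
  refine ⟨Finset.univ.biUnion F, fun i => ?_⟩
  have := (hmixed i).isProbabilityMeasure
  exact (measureReal_mono (Set.compl_subset_compl.2
    (Finset.subset_biUnion_of_mem F (Finset.mem_univ i)))).trans (hF i)

end MixedDistribution

section MinkowskiDim

variable {n : ℕ} {S : Set (EuclideanSpace ℝ (Fin n))} {δ s c : ℝ}

theorem exists_fin_cover_of_finset_cover {D : Finset (EuclideanSpace ℝ (Fin n))}
    (h : S ⊆ ⋃ x ∈ D, Metric.ball x δ) :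
    ∃ x : Fin D.card → EuclideanSpace ℝ (Fin n), S ⊆ ⋃ i, Metric.ball (x i) δ := by
  refine ⟨fun i => D.equivFin.symm i, h.trans (Set.iUnion₂_subset fun x hx => ?_)⟩
  simpa using Set.subset_iUnion (fun i => Metric.ball (D.equivFin.symm i).1 δ) (D.equivFin ⟨x, hx⟩)

theorem coveringNumber_le_card {D : Finset (EuclideanSpace ℝ (Fin n))}
    (h : S ⊆ ⋃ x ∈ D, Metric.ball x δ) : coveringNumber S δ ≤ D.card :=
  Nat.sInf_le (exists_fin_cover_of_finset_cover h)

theorem exists_cover_coveringNumber (hS : Bornology.IsBounded S) (hδ : 0 < δ) :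
    ∃ x : Fin (coveringNumber S δ) → EuclideanSpace ℝ (Fin n), S ⊆ ⋃ i, Metric.ball (x i) δ := by
  obtain ⟨t, ht, hSt⟩ := Metric.totallyBounded_iff.1
    (hS.isCompact_closure.totallyBounded.subset subset_closure) δ hδ
  have hcover := exists_fin_cover_of_finset_cover (D := ht.toFinset) (by simpa using hSt)
  exact Nat.sInf_mem (s := {m : ℕ | ∃ x : Fin m → _, S ⊆ ⋃ i, Metric.ball (x i) δ}) ⟨_, hcover⟩

theorem tendsto_log_mul_rpow_div_log (hc : 0 < c) (s : ℝ) :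
    Tendsto (fun δ : ℝ => ((Real.log (c * δ ^ (-s)) / Real.log (1 / δ) : ℝ) : EReal))
      (𝓝[>] 0) (𝓝 s) := by
  have hlog : Tendsto (fun δ : ℝ => Real.log (1 / δ)) (𝓝[>] 0) atTop := by
    simp only [one_div]
    exact Real.tendsto_log_atTop.comp tendsto_inv_nhdsGT_zero
  have hlim : Tendsto (fun δ : ℝ => Real.log c / Real.log (1 / δ) + s) (𝓝[>] 0) (𝓝 s) := by
    simpa only [zero_add] using (hlog.const_div_atTop (Real.log c)).add_const s
  refine (continuous_coe_real_ereal.tendsto s).comp (hlim.congr' ?_)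
  filter_upwards [hlog.eventually_gt_atTop 0, self_mem_nhdsWithin] with δ hδlog (hδ : 0 < δ)
  rw [Real.log_mul hc.ne' (by positivity), Real.log_rpow hδ, neg_mul, ← mul_neg, ← Real.log_inv,
    ← one_div, add_div, mul_div_cancel_right₀ _ hδlog.ne']

theorem le_lowerMinkowskiDim (hc : 0 < c)
    (h : ∀ᶠ δ in 𝓝[>] 0, c * δ ^ (-s) ≤ coveringNumber S δ) :
    (s : EReal) ≤ lowerMinkowskiDim S := by
  rw [← (tendsto_log_mul_rpow_div_log hc s).liminf_eq]
  refine liminf_le_liminf ?_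
  filter_upwards [h, Ioo_mem_nhdsGT one_pos] with δ hN ⟨hδ0, hδ1⟩
  have hlog : 0 ≤ Real.log (1 / δ) := Real.log_nonneg (one_le_one_div hδ0 hδ1.le)
  exact EReal.coe_le_coe_iff.2 (by gcongr)

theorem upperMinkowskiDim_le (hs : 0 ≤ s) (hc : 1 ≤ c)
    (h : ∀ᶠ δ in 𝓝[>] 0, coveringNumber S δ ≤ c * δ ^ (-s)) : upperMinkowskiDim S ≤ s := by
  rw [← (tendsto_log_mul_rpow_div_log (one_pos.trans_le hc) s).limsup_eq]
  refine limsup_le_limsup ?_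
  filter_upwards [h, Ioo_mem_nhdsGT one_pos] with δ hN ⟨hδ0, hδ1⟩
  have hlog : 0 ≤ Real.log (1 / δ) := Real.log_nonneg (one_le_one_div hδ0 hδ1.le)
  have hone : 1 ≤ c * δ ^ (-s) := one_le_mul_of_one_le_of_one_le hc
    (Real.one_le_rpow_of_pos_of_le_one_of_nonpos hδ0 hδ1.le (neg_nonpos.2 hs))
  refine EReal.coe_le_coe_iff.2 (div_le_div_of_nonneg_right ?_ hlog)
  -- An empty set has covering number `0`, and `Real.log 0 = 0`.
  rcases Nat.eq_zero_or_pos (coveringNumber S δ) with h0 | hpos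
  · rw [h0, Nat.cast_zero, Real.log_zero]
    exact Real.log_nonneg hone
  · exact Real.log_le_log (Nat.cast_pos.2 hpos) hN

theorem lowerMinkowskiDim_le_upperMinkowskiDim (S : Set (EuclideanSpace ℝ (Fin n))) :
    lowerMinkowskiDim S ≤ upperMinkowskiDim S :=
  liminf_le_limsup

theorem le_lowerMinkowskiDim_of_measureReal_ball_le {ν : Measure (EuclideanSpace ℝ (Fin n))}
    [IsFiniteMeasure ν] {C : ℝ} (hν : ∀ᶠ δ in 𝓝[>] 0, ∀ y, ν.real (Metric.ball y δ) ≤ C * δ ^ s)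
    (hS : Bornology.IsBounded S) (hνS : 0 < ν.real S) : (s : EReal) ≤ lowerMinkowskiDim S := by
  have hmass : ∀ᶠ δ in 𝓝[>] 0, ν.real S ≤ coveringNumber S δ * (C * δ ^ s) := by
    filter_upwards [hν, self_mem_nhdsWithin] with δ hball hδ
    obtain ⟨y, hy⟩ := exists_cover_coveringNumber hS hδ
    calc ν.real S ≤ ν.real (⋃ i, Metric.ball (y i) δ) := measureReal_mono hy
      _ ≤ ∑ i, ν.real (Metric.ball (y i) δ) := measureReal_iUnion_fintype_le _
      _ ≤ ∑ _i : Fin (coveringNumber S δ), C * δ ^ s := Finset.sum_le_sum fun i _ => hball (y i)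
      _ = coveringNumber S δ * (C * δ ^ s) := by
          rw [Finset.sum_const, Finset.card_univ, Fintype.card_fin, nsmul_eq_mul]
  have hC : 0 < C := by
    obtain ⟨δ, hδS, hδ : 0 < δ⟩ := (hmass.and self_mem_nhdsWithin).exists
    exact pos_of_mul_pos_left (pos_of_mul_pos_right (hνS.trans_le hδS) (Nat.cast_nonneg _))
      (by positivity)
  refine le_lowerMinkowskiDim (div_pos hνS hC) ?_
  filter_upwards [hmass, self_mem_nhdsWithin] with δ hδS (hδ : 0 < δ)
  rw [Real.rpow_neg hδ.le, ← div_eq_mul_inv, div_div, div_le_iff₀ (by positivity)]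
  exact hδS

theorem exists_finset_forall_abs_sub_lt {R : ℝ} (hR : 0 ≤ R) (hδ : 0 < δ) :
    ∃ D : Finset ℝ, (∀ x, |x| ≤ R → ∃ d ∈ D, |x - d| < δ) ∧ (D.card : ℝ) ≤ 2 * R / δ + 1 := by
  refine ⟨(Finset.range (⌊2 * R / δ⌋₊ + 1)).image fun j : ℕ => -R + j * δ, fun x hx => ?_, ?_⟩
  · obtain ⟨hx1, hx2⟩ := abs_le.1 hx
    have hj : ⌊(x + R) / δ⌋₊ < ⌊2 * R / δ⌋₊ + 1 :=
      Nat.lt_succ_of_le (Nat.floor_le_floor (by gcongr; linarith))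
    refine ⟨_, Finset.mem_image_of_mem _ (Finset.mem_range.2 hj), ?_⟩
    have hlow := Nat.floor_le (div_nonneg (by linarith : 0 ≤ x + R) hδ.le)
    have hupp := Nat.lt_floor_add_one ((x + R) / δ)
    rw [le_div_iff₀ hδ] at hlow
    rw [div_lt_iff₀ hδ] at hupp
    rw [abs_lt]
    constructor <;> linarith
  · calc (((Finset.range (⌊2 * R / δ⌋₊ + 1)).image fun j : ℕ => -R + j * δ).card : ℝ)
        ≤ (⌊2 * R / δ⌋₊ + 1 : ℕ) :=
          Nat.cast_le.2 (Finset.card_image_le.trans (Finset.card_range _).le)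
      _ ≤ 2 * R / δ + 1 := by
          rw [Nat.cast_succ]
          gcongr
          exact Nat.floor_le (by positivity)

theorem dist_lt_of_forall_abs_sub_lt {x y : EuclideanSpace ℝ (Fin n)} (hδ : 0 < δ)
    (h : ∀ i, |x i - y i| < δ / (n + 1)) : dist x y < δ := by
  rw [EuclideanSpace.dist_eq, Real.sqrt_lt' hδ]
  calc ∑ i, dist (x i) (y i) ^ 2 ≤ ∑ _i : Fin n, (δ / (n + 1)) ^ 2 :=
        Finset.sum_le_sum fun i _ => pow_le_pow_left₀ dist_nonneg (h i).le 2
    _ = n / (n + 1) ^ 2 * δ ^ 2 := by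
        rw [Finset.sum_const, Finset.card_univ, Fintype.card_fin, nsmul_eq_mul, div_pow]
        ring
    _ < 1 * δ ^ 2 := by
        gcongr
        rw [div_lt_one (by positivity)]
        nlinarith [(n.cast_nonneg : (0 : ℝ) ≤ n)]
    _ = δ ^ 2 := one_mul _

theorem exists_finset_cover_of_hitCount_compl_le {F D : Finset ℝ} {k : ℕ} (hδ : 0 < δ)
    (hSF : ∀ x ∈ S, hitCount (fun _ => (F : Set ℝ)ᶜ) x ≤ k)
    (hSD : ∀ x ∈ S, ∀ i, ∃ d ∈ D, |x i - d| < δ / (n + 1)) :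
    ∃ E : Finset (EuclideanSpace ℝ (Fin n)), S ⊆ ⋃ y ∈ E, Metric.ball y δ ∧
      E.card ≤ ∑ T : Finset (Fin n) with T.card ≤ k, D.card ^ T.card * F.card ^ (n - T.card) := by
  classical
  let grid (T : Finset (Fin n)) : Finset (Fin n → ℝ) :=
    Fintype.piFinset fun i => if i ∈ T then D else F
  have hgrid (T : Finset (Fin n)) :
      (grid T).card = D.card ^ T.card * F.card ^ (n - T.card) := by
    simp only [grid, Fintype.card_piFinset, apply_ite Finset.card, Finset.prod_ite,
      Finset.prod_const, Finset.filter_not, Finset.filter_univ_mem, ← Finset.compl_eq_univ_sdiff,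
      Finset.card_compl, Fintype.card_fin]
  refine ⟨(({T | T.card ≤ k} : Finset (Finset (Fin n))).biUnion grid).image (WithLp.toLp 2),
    fun x hx => ?_, ?_⟩
  · let T : Finset (Fin n) := {i | x i ∈ (F : Set ℝ)ᶜ}
    have hT : T.card ≤ k := by
      convert hSF x hx using 1
      unfold T hitCount
      congr
    have hnear i : ∃ d ∈ if i ∈ T then D else F, |x i - d| < δ / (n + 1) := by
      by_cases hi : x i ∈ F
      · have hiT : i ∉ T := by simpa [T] using hi
        rw [if_neg hiT]
        exact ⟨x i, hi, by rw [sub_self, abs_zero]; positivity⟩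
      · have hiT : i ∈ T := by simpa [T] using hi
        rw [if_pos hiT]
        exact hSD x hx i
    choose d hd hxd using hnear
    refine Set.mem_iUnion₂.2 ⟨WithLp.toLp 2 d, Finset.mem_image_of_mem _ (Finset.mem_biUnion.2
      ⟨T, (Finset.mem_filter_univ _).2 hT, Fintype.mem_piFinset.2 hd⟩), ?_⟩
    exact dist_lt_of_forall_abs_sub_lt hδ hxd
  · simp only [← hgrid]
    exact Finset.card_image_le.trans Finset.card_biUnion_le

theorem upperMinkowskiDim_le_of_hitCount_compl_le (hS : Bornology.IsBounded S) {F : Finset ℝ}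
    {k : ℕ} (hSF : ∀ x ∈ S, hitCount (fun _ => (F : Set ℝ)ᶜ) x ≤ k) :
    upperMinkowskiDim S ≤ k := by
  obtain ⟨R, hR, hSR⟩ := hS.exists_pos_norm_le
  let A : ℝ := 2 * R * (n + 1) + 1
  have hA : 1 ≤ A := by simp only [A]; linarith [show 0 ≤ 2 * R * (n + 1) by positivity]
  let c : ℝ := 2 ^ n * (A ^ k * (F.card + 1) ^ n)
  have hc : 1 ≤ c := by
    refine one_le_mul_of_one_le_of_one_le (one_le_pow₀ one_le_two)
      (one_le_mul_of_one_le_of_one_le (one_le_pow₀ hA) (one_le_pow₀ ?_))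
    exact le_add_of_nonneg_left F.card.cast_nonneg
  refine upperMinkowskiDim_le (s := k) k.cast_nonneg hc ?_
  filter_upwards [Ioo_mem_nhdsGT one_pos] with δ ⟨hδ0, hδ1⟩
  obtain ⟨D, hD, hDcard⟩ := exists_finset_forall_abs_sub_lt hR.le (div_pos hδ0 n.cast_add_one_pos)
  have hDA : (D.card : ℝ) ≤ A / δ :=
    calc (D.card : ℝ) ≤ 2 * R / (δ / (n + 1)) + 1 := hDcard
      _ ≤ 2 * R / (δ / (n + 1)) + 1 / δ := by gcongr; exact one_le_one_div hδ0 hδ1.le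
      _ = A / δ := by simp only [A]; field_simp
  have hAδ : 1 ≤ A / δ := (one_le_div hδ0).2 (hδ1.le.trans hA)
  have hgrid (T : Finset (Fin n)) (hT : T.card ≤ k) :
      (D.card : ℝ) ^ T.card * F.card ^ (n - T.card) ≤ (A / δ) ^ k * (F.card + 1) ^ n := by
    have hD' : (D.card : ℝ) ^ T.card ≤ (A / δ) ^ k :=
      (pow_le_pow_left₀ D.card.cast_nonneg hDA _).trans (pow_le_pow_right₀ hAδ hT)
    have hF' : (F.card : ℝ) ^ (n - T.card) ≤ (F.card + 1) ^ n :=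
      (pow_le_pow_left₀ F.card.cast_nonneg (le_add_of_nonneg_right zero_le_one) _).trans
        (pow_le_pow_right₀ (le_add_of_nonneg_left F.card.cast_nonneg) (Nat.sub_le _ _))
    gcongr
  obtain ⟨E, hE, hEcard⟩ := exists_finset_cover_of_hitCount_compl_le hδ0 hSF
    fun x hx i => hD (x i) ((PiLp.norm_apply_le x i).trans (hSR x hx))
  calc (coveringNumber S δ : ℝ)
      ≤ ∑ T : Finset (Fin n) with T.card ≤ k, (D.card : ℝ) ^ T.card * F.card ^ (n - T.card) := by
        exact_mod_cast (coveringNumber_le_card hE).trans hEcard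
    _ ≤ ∑ T : Finset (Fin n) with T.card ≤ k, (A / δ) ^ k * (F.card + 1) ^ n :=
        Finset.sum_le_sum fun T hT => hgrid T ((Finset.mem_filter_univ T).1 hT)
    _ ≤ ∑ _T : Finset (Fin n), (A / δ) ^ k * (F.card + 1) ^ n :=
        Finset.sum_le_sum_of_subset_of_nonneg (Finset.filter_subset _ _) fun _ _ _ => by positivity
    _ = 2 ^ n * ((A / δ) ^ k * (F.card + 1) ^ n) := by
        rw [Finset.sum_const, Finset.card_univ, Fintype.card_finset, Fintype.card_fin, nsmul_eq_mul,
          Nat.cast_pow, Nat.cast_ofNat]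
    _ = c * δ ^ (-(k : ℝ)) := by
        rw [Real.rpow_neg hδ0.le, Real.rpow_natCast, div_pow]
        simp only [c]
        ring

end MinkowskiDim

section MixedVector

variable {Ω : Type*} [MeasurableSpace Ω] {P : Measure Ω} {n : ℕ}
  {x : Ω → EuclideanSpace ℝ (Fin n)} {S : Set (EuclideanSpace ℝ (Fin n))} {ρ : Fin n → ℝ}
  {ε a t : ℝ}

theorem aemeasurable_of_forall_apply (hx : ∀ i, AEMeasurable (fun ω => x ω i) P) :
    AEMeasurable x P :=
  (WithLp.measurable_toLp 2 _).comp_aemeasurable (aemeasurable_pi_iff.2 hx)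

theorem exists_isBounded_measureReal_notMem_lt [IsFiniteMeasure P] (hx : AEMeasurable x P) {η : ℝ}
    (hη : 0 < η) : ∃ K, Bornology.IsBounded K ∧ MeasurableSet K ∧ P.real {ω | x ω ∉ K} < η := by
  obtain ⟨m, hm⟩ := exists_measureReal_compl_lt_of_monotone (μ := P.map x)
    (A := fun m : ℕ => Metric.closedBall 0 m) (fun _ => measurableSet_closedBall)
    (fun _ _ h => Metric.closedBall_subset_closedBall (Nat.cast_le.2 h))
    (by simp [Metric.iUnion_closedBall_nat]) hη
  refine ⟨Metric.closedBall 0 m, Metric.isBounded_closedBall, measurableSet_closedBall, ?_⟩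
  rwa [map_measureReal_apply_of_aemeasurable hx measurableSet_closedBall.compl] at hm

theorem le_lowerMinkowskiDim_of_bounded_density [IsFiniteMeasure P]
    (hind : iIndepFun (fun i ω => x ω i) P) (hx : ∀ i, AEMeasurable (fun ω => x ω i) P)
    {G : Fin n → Set ℝ} (hG : ∀ i, MeasurableSet (G i)) {M : ℝ} (hGM : ∀ i y δ, 0 < δ →
      (P.map fun ω => x ω i).real (G i ∩ Metric.ball y δ) ≤ M * δ)
    (hS : Bornology.IsBounded S) {k : ℕ} (hPS : 0 < P.real {ω | x ω ∈ S ∧ k ≤ hitCount G (x ω)}) :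
    (k : EReal) ≤ lowerMinkowskiDim S := by
  have hxP : AEMeasurable x P := aemeasurable_of_forall_apply hx
  let A : Set (EuclideanSpace ℝ (Fin n)) := {y | k ≤ hitCount G y}
  have hA : MeasurableSet A :=
    ((measurable_hitCount hG).comp (WithLp.measurable_ofLp 2 _)) measurableSet_Ici
  let ν : Measure (EuclideanSpace ℝ (Fin n)) := (P.map x).restrict A
  have hball : ∀ᶠ δ in 𝓝[>] 0, ∀ y,
      ν.real (Metric.ball y δ) ≤ n.choose k * M ^ k * δ ^ (k : ℝ) := by
    filter_upwards [self_mem_nhdsWithin] with δ (hδ : 0 < δ) y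
    have hcoord ω (hω : x ω ∈ Metric.ball y δ ∩ A) :
        k ≤ hitCount (fun i => G i ∩ Metric.ball (y i) δ) (x ω) := by
      obtain ⟨T, hT, hTG⟩ := le_hitCount_iff.1 hω.2
      refine le_hitCount_iff.2 ⟨T, hT, fun i hi => ⟨hTG i hi, ?_⟩⟩
      exact (PiLp.norm_apply_le (x ω - y) i).trans_lt (mem_ball_iff_norm.1 hω.1)
    calc ν.real (Metric.ball y δ) = P.real (x ⁻¹' (Metric.ball y δ ∩ A)) := by
          rw [measureReal_restrict_apply' hA,
            map_measureReal_apply_of_aemeasurable hxP (measurableSet_ball.inter hA)]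
      _ ≤ P.real {ω | k ≤ hitCount (fun i => G i ∩ Metric.ball (y i) δ) (x ω)} :=
          measureReal_mono hcoord
      _ ≤ n.choose k * (M * δ) ^ k := by
          simpa only [Fintype.card_fin] using measureReal_le_hitCount_le hind hx
            (fun i => (hG i).inter measurableSet_ball) (fun i => hGM i (y i) δ hδ) k
      _ = n.choose k * M ^ k * δ ^ (k : ℝ) := by rw [mul_pow, Real.rpow_natCast, mul_assoc]
  have hνS : 0 < ν.real S :=
    calc 0 < P.real (x ⁻¹' (S ∩ A)) := hPS
      _ ≤ (P.map x).real (S ∩ A) :=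
          ENNReal.toReal_mono (measure_ne_top _ _) (Measure.le_map_apply hxP _)
      _ = ν.real S := (measureReal_restrict_apply' hA).symm
  exact_mod_cast le_lowerMinkowskiDim_of_measureReal_ball_le hball hS hνS

variable [IsProbabilityMeasure P]

theorem le_lowerMinkowskiDim_of_mem_approxSupports (hind : iIndepFun (fun i ω => x ω i) P)
    (hmixed : ∀ i, IsMixedDistribution (ρ i) (P.map fun ω => x ω i))
    (hS : S ∈ approxSupports P x ε) (ht : 0 < t) (hat : a + t < ∑ i, ρ i)
    (hε : n / (4 * t ^ 2) < 1 - ε) : (a : EReal) ≤ lowerMinkowskiDim S := by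
  have hx i : AEMeasurable (fun ω => x ω i) P := (hmixed i).aemeasurable
  obtain ⟨-, hSb, -, hPS⟩ := hS
  have hPS' : 1 - ε ≤ P.real {ω | x ω ∈ S} :=
    (ENNReal.ofReal_le_iff_le_toReal (measure_ne_top _ _)).1 hPS
  obtain ⟨η, hη, hηn⟩ := exists_pos_mul_lt (sub_pos.2 hat) n
  choose G hG hGρ M hM using fun i => (hmixed i).exists_bounded_density hη
  obtain ⟨M', hM'⟩ := Finite.exists_le M
  have hmean : a + t ≤ ∑ i, (P.map fun ω => x ω i).real (G i) :=
    calc a + t ≤ ∑ i, (ρ i - η) := by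
          rw [Finset.sum_sub_distrib, Finset.sum_const, Finset.card_univ, Fintype.card_fin,
            nsmul_eq_mul]
          linarith
      _ ≤ ∑ i, (P.map fun ω => x ω i).real (G i) := Finset.sum_le_sum fun i _ => hGρ i
  have hdev : P.real {ω | hitCount G (x ω) < a} < 1 - ε :=
    (measureReal_hitCount_lt_le hind hx hG ht hmean).trans_lt (by rwa [Fintype.card_fin])
  have hsub : {ω | x ω ∈ S} ⊆
      {ω | x ω ∈ S ∧ ⌈a⌉₊ ≤ hitCount G (x ω)} ∪ {ω | hitCount G (x ω) < a} := fun ω hω =>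
    or_iff_not_imp_right.2 fun hωa => ⟨hω, Nat.ceil_le.2 (not_lt.1 hωa)⟩
  have hpos : 0 < P.real {ω | x ω ∈ S ∧ ⌈a⌉₊ ≤ hitCount G (x ω)} := by
    linarith [(measureReal_mono (μ := P) hsub).trans (measureReal_union_le _ _)]
  calc (a : EReal) ≤ (⌈a⌉₊ : ℕ) := by exact_mod_cast Nat.le_ceil a
    _ ≤ lowerMinkowskiDim S := le_lowerMinkowskiDim_of_bounded_density hind hx hG
        (fun i y δ hδ => (hM i y δ hδ).trans (by gcongr; exact hM' i)) hSb hpos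

theorem mem_approxSupports_of_measureReal_notMem_le (hSb : Bornology.IsBounded S)
    (hSm : MeasurableSet S) (hPS : P.real {ω | x ω ∉ S} ≤ ε) (hε : ε < 1) :
    S ∈ approxSupports P x ε := by
  have hle : 1 - ε ≤ P.real {ω | x ω ∈ S} := by
    have hunion := measureReal_union_le (μ := P) {ω | x ω ∈ S} {ω | x ω ∈ S}ᶜ
    rw [Set.union_compl_self, probReal_univ] at hunion
    exact sub_le_iff_le_add.2 (hunion.trans (add_le_add_right hPS _))
  obtain ⟨ω, hω⟩ := nonempty_of_measureReal_ne_zero ((sub_pos.2 hε).trans_le hle).ne'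
  exact ⟨⟨x ω, hω⟩, hSb, hSm, ENNReal.ofReal_le_of_le_toReal hle⟩

theorem exists_mem_approxSupports_upperMinkowskiDim_le (hind : iIndepFun (fun i ω => x ω i) P)
    (hmixed : ∀ i, IsMixedDistribution (ρ i) (P.map fun ω => x ω i)) (ht : 0 < t)
    (hat : ∑ i, ρ i + t < a) (hε : n / (4 * t ^ 2) < ε) (hε1 : ε < 1) :
    ∃ S ∈ approxSupports P x ε, upperMinkowskiDim S ≤ a := by
  have hx i : AEMeasurable (fun ω => x ω i) P := (hmixed i).aemeasurable
  have ha : 0 ≤ a := by linarith [Finset.sum_nonneg fun i (_ : i ∈ Finset.univ) => (hmixed i).1]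
  obtain ⟨η, hη, hηn⟩ := exists_pos_mul_lt (sub_pos.2 hat) n
  obtain ⟨F, hF⟩ := exists_finset_forall_measureReal_compl_le hmixed hη
  obtain ⟨K, hKb, hKm, hK⟩ :=
    exists_isBounded_measureReal_notMem_lt (aemeasurable_of_forall_apply hx) (sub_pos.2 hε)
  have hFm : MeasurableSet (F : Set ℝ)ᶜ := F.measurableSet.compl
  have hmean : ∑ i, (P.map fun ω => x ω i).real (F : Set ℝ)ᶜ + t ≤ a :=
    calc ∑ i, (P.map fun ω => x ω i).real (F : Set ℝ)ᶜ + t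
        ≤ ∑ i, (ρ i + η) + t := by gcongr with i; exact hF i
      _ ≤ a := by
          rw [Finset.sum_add_distrib, Finset.sum_const, Finset.card_univ, Fintype.card_fin,
            nsmul_eq_mul]
          linarith
  let A : Set (EuclideanSpace ℝ (Fin n)) := {y | hitCount (fun _ => (F : Set ℝ)ᶜ) y ≤ ⌊a⌋₊}
  have hA : MeasurableSet A :=
    ((measurable_hitCount fun _ => hFm).comp (WithLp.measurable_ofLp 2 _)) measurableSet_Iic
  have hPA : P.real {ω | x ω ∉ A} ≤ n / (4 * t ^ 2) := by
    simpa only [A, Set.mem_ofPred_eq, not_le, Nat.floor_lt ha, Fintype.card_fin] using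
      measureReal_lt_hitCount_le hind hx (fun _ => hFm) ht hmean
  have hPS : P.real {ω | x ω ∉ K ∩ A} ≤ ε :=
    calc P.real {ω | x ω ∉ K ∩ A} ≤ P.real ({ω | x ω ∉ K} ∪ {ω | x ω ∉ A}) :=
          measureReal_mono fun _ => not_and_or.1
      _ ≤ P.real {ω | x ω ∉ K} + P.real {ω | x ω ∉ A} := measureReal_union_le _ _
      _ ≤ ε := by linarith
  refine ⟨K ∩ A, mem_approxSupports_of_measureReal_notMem_le (hKb.subset Set.inter_subset_left)
    (hKm.inter hA) hPS hε1, ?_⟩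
  calc upperMinkowskiDim (K ∩ A) ≤ (⌊a⌋₊ : ℕ) :=
        upperMinkowskiDim_le_of_hitCount_compl_le (hKb.subset Set.inter_subset_left)
          fun _ hy => hy.2
    _ ≤ a := by exact_mod_cast Nat.floor_le ha

end MixedVector

section MinkowskiRate

variable {Ω : Type*} [MeasurableSpace Ω] {P : Measure Ω}
  {x : (n : ℕ) → Ω → EuclideanSpace ℝ (Fin n)} {ρ : (n : ℕ) → Fin n → ℝ} {a r ε : ℝ}

theorem lowerMinkowskiRate_le_upperMinkowskiRate (P : Measure Ω)
    (x : (n : ℕ) → Ω → EuclideanSpace ℝ (Fin n)) (ε : ℝ) :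
    lowerMinkowskiRate P x ε ≤ upperMinkowskiRate P x ε :=
  limsup_le_limsup <| .of_forall fun _ => iInf₂_mono fun S _ =>
    EReal.div_le_div_right_of_nonneg (by positivity) (lowerMinkowskiDim_le_upperMinkowskiDim S)

theorem le_lowerMinkowskiRate (h : ∀ a < r, ∀ᶠ n : ℕ in atTop, ∀ S ∈ approxSupports P (x n) ε,
    ((a * n : ℝ) : EReal) ≤ lowerMinkowskiDim S) : (r : EReal) ≤ lowerMinkowskiRate P x ε := by
  refine EReal.ge_of_forall_gt_iff_ge.1 fun a ha =>
    le_limsup_of_frequently_le (Eventually.frequently ?_) (by isBoundedDefault)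
  filter_upwards [h a (EReal.coe_lt_coe_iff.1 ha), eventually_gt_atTop 0] with n hn hn0
  refine le_iInf₂ fun S hS => ?_
  rw [EReal.le_div_iff_mul_le (by exact_mod_cast hn0) (EReal.natCast_ne_top n)]
  exact_mod_cast hn S hS

theorem upperMinkowskiRate_le (h : ∀ a > r, ∀ᶠ n : ℕ in atTop, ∃ S ∈ approxSupports P (x n) ε,
    upperMinkowskiDim S ≤ ((a * n : ℝ) : EReal)) : upperMinkowskiRate P x ε ≤ r := by
  refine EReal.le_of_forall_lt_iff_le.1 fun a ha => limsup_le_of_le (by isBoundedDefault) ?_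
  filter_upwards [h a (EReal.coe_lt_coe_iff.1 ha), eventually_gt_atTop 0] with n ⟨S, hS, hSa⟩ hn0
  refine (iInf₂_le S hS).trans ?_
  rw [EReal.div_le_iff_le_mul (by exact_mod_cast hn0) (EReal.natCast_ne_top n), mul_comm]
  exact_mod_cast hSa

theorem tendsto_natCast_div_mul_sq (η : ℝ) :
    Tendsto (fun n : ℕ => (n : ℝ) / (4 * (n * η) ^ 2)) atTop (𝓝 0) := by
  refine (tendsto_const_div_atTop_nhds_zero_nat (1 / (4 * η ^ 2))).congr fun n => ?_
  field_simp

theorem eventually_le_lowerMinkowskiDim [IsProbabilityMeasure P]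
    (hind : ∀ n, iIndepFun (fun i ω => x n ω i) P)
    (hmixed : ∀ n i, IsMixedDistribution (ρ n i) (P.map fun ω => x n ω i))
    (hρ : Tendsto (fun n => (∑ i, ρ n i) / n) atTop (𝓝 r)) (hε : ε < 1) (ha : a < r) :
    ∀ᶠ n : ℕ in atTop, ∀ S ∈ approxSupports P (x n) ε,
      ((a * n : ℝ) : EReal) ≤ lowerMinkowskiDim S := by
  obtain ⟨b, hab, hbr⟩ := exists_between ha
  filter_upwards [hρ.eventually_const_lt hbr, eventually_gt_atTop 0,
    (tendsto_natCast_div_mul_sq (b - a)).eventually_lt_const (sub_pos.2 hε)] with n hb hn hcheb S hS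
  have hn' : (0 : ℝ) < n := Nat.cast_pos.2 hn
  rw [lt_div_iff₀ hn'] at hb
  exact le_lowerMinkowskiDim_of_mem_approxSupports (hind n) (hmixed n) hS
    (mul_pos hn' (sub_pos.2 hab)) (by linarith) hcheb

theorem eventually_exists_upperMinkowskiDim_le [IsProbabilityMeasure P]
    (hind : ∀ n, iIndepFun (fun i ω => x n ω i) P)
    (hmixed : ∀ n i, IsMixedDistribution (ρ n i) (P.map fun ω => x n ω i))
    (hρ : Tendsto (fun n => (∑ i, ρ n i) / n) atTop (𝓝 r)) (hε : ε ∈ Set.Ioo 0 1) (ha : r < a) :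
    ∀ᶠ n : ℕ in atTop, ∃ S ∈ approxSupports P (x n) ε,
      upperMinkowskiDim S ≤ ((a * n : ℝ) : EReal) := by
  obtain ⟨b, hrb, hba⟩ := exists_between ha
  filter_upwards [hρ.eventually_lt_const hrb, eventually_gt_atTop 0,
    (tendsto_natCast_div_mul_sq (a - b)).eventually_lt_const hε.1] with n hb hn hcheb
  have hn' : (0 : ℝ) < n := Nat.cast_pos.2 hn
  rw [div_lt_iff₀ hn'] at hb
  exact exists_mem_approxSupports_upperMinkowskiDim_le (hind n) (hmixed n)
    (mul_pos hn' (sub_pos.2 hba)) (by linarith) hcheb hε.2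

end MinkowskiRate

section ConcatSource

variable {lam : ℝ}

theorem sum_ite_lt_sub {n l : ℕ} (hl : l ≤ n) (a b : ℝ) :
    ∑ i : Fin n, (if (i : ℕ) < n - l then a else b) = (n - l) * a + l * b := by
  obtain ⟨m, rfl⟩ := Nat.exists_eq_add_of_le' hl
  simp [Fin.sum_univ_add]

theorem numZ_le (hlam : lam ≤ 1) (n : ℕ) : numZ lam n ≤ n :=
  Nat.floor_le_of_le (mul_le_of_le_one_left n.cast_nonneg hlam)

theorem tendsto_numZ_div (hlam : 0 ≤ lam) :
    Tendsto (fun n : ℕ => (numZ lam n : ℝ) / n) atTop (𝓝 lam) :=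
  (tendsto_nat_floor_mul_div_atTop hlam).comp tendsto_natCast_atTop_atTop

theorem tendsto_sum_ite_lt_numZ_div (hlam : lam ∈ Set.Icc (0 : ℝ) 1) (a b : ℝ) :
    Tendsto (fun n : ℕ => (∑ i : Fin n, if (i : ℕ) < n - numZ lam n then a else b) / (n : ℝ))
      atTop (𝓝 ((1 - lam) * a + lam * b)) := by
  have hlim := tendsto_numZ_div hlam.1
  refine (((hlim.const_sub 1).mul_const a).add (hlim.mul_const b)).congr' ?_
  filter_upwards [eventually_gt_atTop 0] with n hn
  rw [sum_ite_lt_sub (numZ_le hlam.2 n)]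
  field_simp

end ConcatSource

end SignalSeparation

open SignalSeparation in
theorem proposition3_general {Ω : Type*} [MeasurableSpace Ω] {P : Measure Ω}
    [IsProbabilityMeasure P] {x : (n : ℕ) → Ω → EuclideanSpace ℝ (Fin n)}
    {ρ : (n : ℕ) → Fin n → ℝ} {r ε : ℝ} (hind : ∀ n, iIndepFun (fun i ω => x n ω i) P)
    (hmixed : ∀ n i, IsMixedDistribution (ρ n i) (P.map fun ω => x n ω i))
    (hρ : Tendsto (fun n => (∑ i, ρ n i) / n) atTop (𝓝 r)) (hε : ε ∈ Set.Ioo 0 1) :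
    IsMinkowskiRate P x ε r := by
  have hlower : (r : EReal) ≤ lowerMinkowskiRate P x ε :=
    le_lowerMinkowskiRate fun _ => eventually_le_lowerMinkowskiDim hind hmixed hρ hε.2
  have hupper : upperMinkowskiRate P x ε ≤ r :=
    upperMinkowskiRate_le fun _ => eventually_exists_upperMinkowskiDim_le hind hmixed hρ hε
  have hle := lowerMinkowskiRate_le_upperMinkowskiRate P x ε
  exact ⟨le_antisymm (hle.trans hupper) hlower, le_antisymm hupper (hlower.trans hle)⟩

theorem proposition3 {Ω : Type*} [MeasurableSpace Ω] (P : Measure Ω) [IsProbabilityMeasure P]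
    (Y Z : ℕ → Ω → ℝ) (hY : ∀ i, Measurable (Y i)) (hZ : ∀ i, Measurable (Z i))
    (lam : ℝ) (hlam : lam ∈ Set.Icc (0 : ℝ) 1) (ρ₁ ρ₂ : ℝ)
    (hmixed : SignalSeparation.IsMixedSource P lam ρ₁ ρ₂ Y Z)
    (ε : ℝ) (hε : ε ∈ Set.Ioo (0 : ℝ) 1) :
    SignalSeparation.IsMinkowskiRate P (SignalSeparation.concatSource lam Y Z) ε
      ((1 - lam) * ρ₁ + lam * ρ₂) := by
  obtain ⟨μ₁, μ₂, h₁, h₂, h⟩ := hmixed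
  exact proposition3_general
    (ρ := fun n i => if (i : ℕ) < n - SignalSeparation.numZ lam n then ρ₁ else ρ₂)
    (fun n => (h n).1) (fun n i => by rw [(h n).2 i]; split_ifs; exacts [h₁, h₂])
    (SignalSeparation.tendsto_sum_ite_lt_numZ_div hlam ρ₁ ρ₂) hε
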